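/- For positive integers $2\le k\le n$ let $\mathcal S^n_+$ be the cone of real symmetric positive semidefinite $n\times n$ matrices, let $\mathcal S^{n,k}$ be the set of all real symmetric $n\times n$ matrices all of whose $k\times k$ principal submatrices are positive semidefinite, let $\|\cdot\|_F$ be the Frobenius norm, and put $$\overline{\mathrm{dist}}_F(\mathcal S^{n,k},\mathcal S^n_+)=\sup_{M\in\mathcal S^{n,k},\ \|M\|_F=1}\ \inf_{N\in\mathcal S^n_+}\|M-N\|_F .$$ Theorem. Assume $n\ge 97$ and $\frac{3n}{4}\le k\le n$. Then $$\overline{\mathrm{dist}}_F(\mathcal S^{n,k},\mathcal S^n_+)\le 96\left(\frac{n-k}{n}\right)^{3/2}.$$ -/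

import Mathlib

open scoped Matrix.Norms.Frobenius

noncomputable section

/-- The cone of real symmetric positive semidefinite `n × n` matrices. -/
def psdCone (n : ℕ) : Set (Matrix (Fin n) (Fin n) ℝ) :=
  {X | X.PosSemidef}

/-- The `k`-PSD closure: the real symmetric `n × n` matrices all of whose `k × k` principal
submatrices are positive semidefinite. -/
def kPSDClosure (n k : ℕ) : Set (Matrix (Fin n) (Fin n) ℝ) :=
  {M | M.IsSymm ∧ ∀ J : Finset (Fin n), J.card = k →
    (M.submatrix (fun i : J => (i : Fin n)) (fun i : J => (i : Fin n))).PosSemidef}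

/-- The Frobenius distance `inf_{N ∈ S} ‖M - N‖_F` from a matrix `M` to a set `S` of matrices. -/
def frobeniusDist {n : ℕ} (M : Matrix (Fin n) (Fin n) ℝ) (S : Set (Matrix (Fin n) (Fin n) ℝ)) : ℝ :=
  ⨅ N : S, ‖M - (N : Matrix (Fin n) (Fin n) ℝ)‖

/-- The normalized Frobenius distance between two sets of matrices: the supremum of the Frobenius
distances to `S` of the matrices `M ∈ T` with `‖M‖_F = 1`. -/
def normalizedFrobeniusDist {n : ℕ} (T S : Set (Matrix (Fin n) (Fin n) ℝ)) : ℝ :=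
  sSup {d : ℝ | ∃ M ∈ T, ‖M‖ = 1 ∧ d = frobeniusDist M S}

/-- The infimum in the distance to the PSD cone is a genuine one. -/
theorem frobeniusDist_psdCone_isGLB {n : ℕ} (M : Matrix (Fin n) (Fin n) ℝ) :
    IsGLB (Set.range fun N : psdCone n => ‖M - (N : Matrix (Fin n) (Fin n) ℝ)‖)
      (frobeniusDist M (psdCone n)) := by
  have : Nonempty (psdCone n) := ⟨⟨0, Matrix.PosSemidef.zero⟩⟩
  exact isGLB_ciInf ⟨0, by rintro _ ⟨N, rfl⟩; exact norm_nonneg _⟩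

/-- The supremum in the normalized distance from the `k`-PSD closure to the PSD cone is a genuine
one: it is over a non-empty bounded set. -/
theorem normalizedFrobeniusDist_isLUB {n : ℕ} (hn : 1 ≤ n) (k : ℕ) :
    IsLUB {d : ℝ | ∃ M ∈ kPSDClosure n k, ‖M‖ = 1 ∧ d = frobeniusDist M (psdCone n)}
      (normalizedFrobeniusDist (kPSDClosure n k) (psdCone n)) := by
  apply isLUB_csSup
  · have hne : (1 : Matrix (Fin n) (Fin n) ℝ) ≠ 0 := by
      have : Nonempty (Fin n) := ⟨⟨0, hn⟩⟩
      exact one_ne_zero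
    have hpsd : (‖(1 : Matrix (Fin n) (Fin n) ℝ)‖⁻¹ • (1 : Matrix (Fin n) (Fin n) ℝ)).PosSemidef :=
      Matrix.PosSemidef.one.smul (inv_nonneg.2 (norm_nonneg _))
    refine ⟨_, ‖(1 : Matrix (Fin n) (Fin n) ℝ)‖⁻¹ • 1, ⟨?_, fun J _ => hpsd.submatrix _⟩, ?_, rfl⟩
    · simp [Matrix.IsSymm]
    · rw [norm_smul, norm_inv, norm_norm, inv_mul_cancel₀ (norm_ne_zero_iff.2 hne)]
  · refine ⟨1, ?_⟩
    rintro _ ⟨M, -, hM, rfl⟩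
    have := (frobeniusDist_psdCone_isGLB M).1 ⟨⟨0, Matrix.PosSemidef.zero⟩, rfl⟩
    simpa [hM] using this

end

/-! Split `M = P - N` spectrally and put `r = n - k`, `S = ‖N‖²`, `Q = ‖P‖²`; the distance is at
most `‖N‖`. By interlacing `N` has rank at most `r`, so `(tr N)² ≤ r S`. Deleting any `r` indices
leaves a PSD block of `M`, whose entrywise product with `N` has nonnegative entry sum (Schur). The
deleted indices are averaged over the `r`-subsets of `L`, the indices with `N i i ≤ 2 tr N / n`; `m
= #L ≥ n/2`. With weights of constant mean, the average is a multiple of `⟨N, M⟩ = -S` up to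
corrections on `L`, and gives `(m - 1 - r) S ≤ r D` with `D = ∑ i ∈ L, N i i * P i i`.
Cauchy–Schwarz and the choice of `L` give `D² ≤ (2 r S / n) Q`: this extra factor `r / n` improves
the exponent from `1` to `3/2`. -/

open Finset Matrix

/-! ### Spectral splitting and interlacing -/

/-- The spectral decomposition of a symmetric matrix into positive and negative part. -/
theorem exists_spectral_split {n : ℕ} {M : Matrix (Fin n) (Fin n) ℝ} (hM : M.IsHermitian) :
    ∃ P N : Matrix (Fin n) (Fin n) ℝ, P.PosSemidef ∧ N.PosSemidef ∧ M = P - N ∧ P * N = 0 ∧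
      N.trace = ∑ i, max (-hM.eigenvalues i) 0 ∧
      (N * N).trace = ∑ i, max (-hM.eigenvalues i) 0 ^ 2 := by
  set U : Matrix (Fin n) (Fin n) ℝ := (hM.eigenvectorUnitary : Matrix (Fin n) (Fin n) ℝ) with hU
  have hUU : Uᴴ * U = 1 := Unitary.coe_star_mul_self hM.eigenvectorUnitary
  have hspec : M = U * diagonal hM.eigenvalues * Uᴴ := by
    have := hM.spectral_theorem
    rw [Unitary.conjStarAlgAut_apply] at this
    simpa [star_eq_conjTranspose] using this
  have hmul (x y : Fin n → ℝ) : (U * diagonal x * Uᴴ) * (U * diagonal y * Uᴴ)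
      = U * diagonal (fun i => x i * y i) * Uᴴ := by
    calc _ = U * diagonal x * (Uᴴ * U) * diagonal y * Uᴴ := by simp only [Matrix.mul_assoc]
      _ = _ := by rw [hUU, Matrix.mul_one, Matrix.mul_assoc U, diagonal_mul_diagonal]
  have htr (x : Fin n → ℝ) : (U * diagonal x * Uᴴ).trace = ∑ i, x i := by
    rw [Matrix.trace_mul_comm, ← Matrix.mul_assoc, hUU, Matrix.one_mul, trace_diagonal]
  have hpsd (x : Fin n → ℝ) (hx : 0 ≤ x) : (U * diagonal x * Uᴴ).PosSemidef :=
    (PosSemidef.diagonal hx).mul_mul_conjTranspose_same U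
  refine ⟨U * diagonal (fun i => max (hM.eigenvalues i) 0) * Uᴴ,
    U * diagonal (fun i => max (-hM.eigenvalues i) 0) * Uᴴ,
    hpsd _ fun i => le_max_right _ _, hpsd _ fun i => le_max_right _ _, ?_, ?_, htr _, ?_⟩
  · rw [← Matrix.sub_mul, ← Matrix.mul_sub, diagonal_sub]
    refine hspec.trans ?_
    congr 3
    funext i
    rcases le_total (hM.eigenvalues i) 0 with h | h <;> simp [h]
  · rw [hmul]
    have : (fun i => max (hM.eigenvalues i) 0 * max (-hM.eigenvalues i) 0) = 0 := by
      funext i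
      rcases le_total (hM.eigenvalues i) 0 with h | h <;> simp [h]
    rw [this]
    simp
  · rw [hmul, htr]
    simp only [sq]

/-- The quadratic form of a principal submatrix, written with vectors supported on the index set. -/
theorem Matrix.PosSemidef.dotProduct_mulVec_of_support {n : ℕ} {M : Matrix (Fin n) (Fin n) ℝ}
    {J : Finset (Fin n)}
    (h : (M.submatrix (fun i : J => (i : Fin n)) (fun i : J => (i : Fin n))).PosSemidef)
    {x : Fin n → ℝ} (hx : ∀ i ∉ J, x i = 0) : 0 ≤ x ⬝ᵥ (M *ᵥ x) := by
  have h0 := h.dotProduct_mulVec_nonneg (fun i : J => x i)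
  have hs (f : Fin n → ℝ) (hf : ∀ i ∉ J, f i = 0) : ∑ i : J, f i = ∑ i, f i := by
    rw [Finset.sum_coe_sort J f]
    exact Finset.sum_subset (Finset.subset_univ _) fun i _ hi => hf i hi
  refine h0.trans_eq (Eq.symm ?_)
  simp only [dotProduct, mulVec, submatrix_apply, Pi.star_apply, star_trivial]
  rw [← hs _ fun i hi => by simp [hx i hi]]
  refine Finset.sum_congr rfl fun i _ => ?_
  rw [hs (fun j => M i j * x j) fun i hi => by simp [hx i hi]]

/-- Cauchy interlacing: a matrix with a positive semidefinite principal submatrix of size `k` has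
at most `n - k` negative eigenvalues. -/
theorem card_neg_eigenvalues_le {n : ℕ} {M : Matrix (Fin n) (Fin n) ℝ} (hM : M.IsHermitian)
    {J : Finset (Fin n)}
    (h : (M.submatrix (fun i : J => (i : Fin n)) (fun i : J => (i : Fin n))).PosSemidef) :
    (univ.filter fun i => hM.eigenvalues i < 0).card ≤ n - J.card := by
  by_contra! hlt
  set S := univ.filter fun i => hM.eigenvalues i < 0 with hS
  let v : Fin n → Fin n → ℝ := fun a => (hM.eigenvectorBasis a).ofLp
  -- Restriction to `Jᶜ` of combinations of negative eigenvectors. A nonzero kernel element gives a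
  -- vector supported on `J` with negative quadratic form.
  let f : (S → ℝ) →ₗ[ℝ] ((Jᶜ : Finset (Fin n)) → ℝ) :=
    { toFun := fun c j => ∑ a : S, c a * v a j
      map_add' := fun c d => by ext j; simp [add_mul, Finset.sum_add_distrib]
      map_smul' := fun t c => by ext j; simp [Finset.mul_sum, mul_assoc] }
  have hker : LinearMap.ker f ≠ ⊥ := by
    apply LinearMap.ker_ne_bot_of_finrank_lt
    simpa [Finset.card_compl] using hlt
  obtain ⟨c, hc, hc0⟩ := (Submodule.ne_bot_iff _).1 hker
  let x : Fin n → ℝ := ∑ a : S, c a • v a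
  have hx : ∀ i ∉ J, x i = 0 := by
    intro i hi
    have := congrFun (LinearMap.mem_ker.1 hc) ⟨i, by simpa using hi⟩
    simpa [f, x, Finset.sum_apply] using this
  have hv (a b : Fin n) : v a ⬝ᵥ v b = if a = b then 1 else 0 := by
    have := orthonormal_iff_ite.1 hM.eigenvectorBasis.orthonormal a b
    rw [← this, EuclideanSpace.inner_eq_star_dotProduct, dotProduct_comm]
    simp [v]
  have hq : x ⬝ᵥ (M *ᵥ x) = ∑ a : S, c a ^ 2 * hM.eigenvalues a := by
    have hMx : M *ᵥ x = ∑ a : S, (c a * hM.eigenvalues a) • v a := by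
      rw [Matrix.mulVec_sum]
      refine Finset.sum_congr rfl fun a _ => ?_
      rw [mulVec_smul, hM.mulVec_eigenvectorBasis, smul_smul]
    rw [hMx]
    simp only [x, sum_dotProduct, dotProduct_sum, smul_dotProduct, dotProduct_smul, hv, smul_eq_mul,
      Subtype.coe_inj, mul_ite, mul_one, mul_zero]
    refine Finset.sum_congr rfl fun a _ => ?_
    simp
    ring
  have hnn := h.dotProduct_mulVec_of_support hx
  obtain ⟨a, ha⟩ := Function.ne_iff.1 hc0
  have hneg (b : S) : hM.eigenvalues b < 0 := (Finset.mem_filter.1 b.2).2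
  rw [hq] at hnn
  refine hnn.not_gt (Finset.sum_neg' (fun b _ => ?_) ⟨a, mem_univ _, ?_⟩)
  · exact mul_nonpos_of_nonneg_of_nonpos (sq_nonneg _) (hneg b).le
  · exact mul_neg_of_pos_of_neg (sq_pos_of_ne_zero ha) (hneg a)

/-! ### Schur products and averaging over deleted index sets -/

open scoped MatrixOrder in
/-- A weighted form of the Schur product theorem. -/
theorem Matrix.PosSemidef.sum_mul_nonneg {n : ℕ} {A B : Matrix (Fin n) (Fin n) ℝ}
    (hA : A.PosSemidef) (d : Fin n → ℝ)
    (hB : ∀ x : Fin n → ℝ, 0 ≤ (fun i => d i * x i) ⬝ᵥ (B *ᵥ fun i => d i * x i)) :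
    0 ≤ ∑ i, ∑ j, d i * d j * (A i j * B i j) := by
  obtain ⟨C, rfl⟩ : ∃ C : Matrix (Fin n) (Fin n) ℝ, A = Cᴴ * C := by
    obtain ⟨C, hC, -, rfl⟩ := CFC.exists_sqrt_of_isSelfAdjoint_of_quasispectrumRestricts
      hA.isHermitian (QuasispectrumRestricts.nnreal_of_nonneg hA.nonneg)
    exact ⟨C, congrArg (· * C) hC.star_eq.symm⟩
  have : ∑ i, ∑ j, d i * d j * ((Cᴴ * C) i j * B i j)
      = ∑ a, (fun i => d i * C a i) ⬝ᵥ (B *ᵥ fun i => d i * C a i) := by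
    simp only [dotProduct, mulVec, mul_apply, conjTranspose_apply, star_trivial, Finset.mul_sum,
      Finset.sum_mul]
    symm
    rw [Finset.sum_comm]
    refine Finset.sum_congr rfl fun i _ => ?_
    rw [Finset.sum_comm]
    exact Finset.sum_congr rfl fun a _ => Finset.sum_congr rfl fun j _ => by ring
  rw [this]
  exact Finset.sum_nonneg fun a _ => hB _

/-- The number of `r`-subsets of `L` which avoid a subset `T` of `L`. -/
theorem card_powersetCard_filter_disjoint {α : Type*} [DecidableEq α] {L T : Finset α} (hT : T ⊆ L)
    (r : ℕ) :
    ((L.powersetCard r).filter fun J => Disjoint T J).card = (L.card - T.card).choose r := by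
  rw [← card_sdiff_of_subset hT, ← card_powersetCard]
  congr 1
  ext J
  simp only [mem_filter, mem_powersetCard, subset_sdiff, disjoint_comm]
  tauto

/-- The scaled diagonal of the random compression: coordinates outside `L` keep the weight
`#L - r`, the coordinates of `L` are either dropped or get the weight `#L`. -/
def dropWeight {α : Type*} [DecidableEq α] (L : Finset α) (r : ℕ) (J : Finset α) (i : α) : ℝ :=
  if i ∈ L then (if i ∈ J then 0 else (L.card : ℝ)) else (L.card : ℝ) - r

/-- For `J` uniform among the `r`-subsets of `L`, every weight has mean `#L - r`, inside `L` or
outside; the second moments are therefore constant except on `L × L`, with a further term on its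
diagonal. The factor `#L - 1` clears the denominator of the pair probability. -/
theorem sum_dropWeight_mul {α : Type*} [DecidableEq α] {L : Finset α} {r : ℕ} (hr : r < L.card)
    (i j : α) :
    ((L.card : ℝ) - 1) * ∑ J ∈ L.powersetCard r, dropWeight L r J i * dropWeight L r J j
      = L.card.choose r * ((L.card : ℝ) - r) * (((L.card : ℝ) - r) * ((L.card : ℝ) - 1)
        - r * (if i ∈ L ∧ j ∈ L then 1 else 0)
        + L.card * r * (if i ∈ L ∧ i = j then 1 else 0)) := by
  obtain ⟨m, hm⟩ : ∃ m, L.card = m + 1 := ⟨L.card - 1, by omega⟩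
  have key {T : Finset α} (hT : T ⊆ L) (c : ℝ) :
      ∑ J ∈ L.powersetCard r, (if Disjoint T J then c else 0)
        = ((L.card - T.card).choose r : ℝ) * c := by
    rw [← Finset.sum_filter, Finset.sum_const, card_powersetCard_filter_disjoint hT, nsmul_eq_mul]
  have h1 : (m.choose r : ℝ) * (m + 1) = (m + 1).choose r * ((m + 1 : ℝ) - r) := by
    have := Nat.choose_mul_succ_eq m r
    rw [← Nat.cast_add_one, ← Nat.cast_sub (by omega)]
    exact_mod_cast this
  by_cases hi : i ∈ L <;> by_cases hj : j ∈ L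
  · by_cases hij : i = j
    · subst hij
      have h0 := key (T := {i}) (by simpa using hi) ((L.card : ℝ) ^ 2)
      have : ∑ J ∈ L.powersetCard r, dropWeight L r J i * dropWeight L r J i
          = (m.choose r : ℝ) * (m + 1) ^ 2 := by
        rw [card_singleton, hm] at h0
        push_cast at h0
        rw [← h0]
        refine Finset.sum_congr rfl fun J _ => ?_
        by_cases h : i ∈ J <;> simp [dropWeight, hi, h, hm, sq]
      rw [this, hm]
      simp only [hi, and_self, if_true]
      push_cast
      linear_combination (m * (m + 1) : ℝ) * h1
    · have h2 : 2 ≤ L.card := by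
        have : ({i, j} : Finset α) ⊆ L := by simp [insert_subset_iff, hi, hj]
        simpa [card_pair hij] using card_le_card this
      obtain ⟨p, rfl⟩ : ∃ p, m = p + 1 := ⟨m - 1, by omega⟩
      have h0 := key (T := {i, j}) (by simp [insert_subset_iff, hi, hj]) ((L.card : ℝ) ^ 2)
      have : ∑ J ∈ L.powersetCard r, dropWeight L r J i * dropWeight L r J j
          = (p.choose r : ℝ) * (p + 1 + 1) ^ 2 := by
        rw [card_pair hij, hm] at h0
        push_cast at h0
        rw [← h0]
        refine Finset.sum_congr rfl fun J _ => ?_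
        by_cases h : i ∈ J <;> by_cases h' : j ∈ J <;>
          simp [dropWeight, hi, hj, h, h', hm, sq]
      have h3 : (p.choose r : ℝ) * (p + 1) = (p + 1).choose r * ((p + 1 : ℝ) - r) := by
        have := Nat.choose_mul_succ_eq p r
        rw [← Nat.cast_add_one, ← Nat.cast_sub (by omega)]
        exact_mod_cast this
      rw [this, hm]
      simp only [hi, hj, hij, and_self, and_false, if_true, if_false]
      push_cast at h1 ⊢
      linear_combination ((p + 1 : ℝ) + 1) * ((p + 1 : ℝ) - r) * h1 + (p + 1 + 1 : ℝ) ^ 2 * h3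
  · have hij : i ≠ j := fun h => hj (h ▸ hi)
    have h0 := key (T := {i}) (by simpa using hi) ((L.card : ℝ) * (L.card - r))
    have : ∑ J ∈ L.powersetCard r, dropWeight L r J i * dropWeight L r J j
        = (m.choose r : ℝ) * ((m + 1) * (m + 1 - r)) := by
      rw [card_singleton, hm] at h0
      push_cast at h0
      rw [← h0]
      refine Finset.sum_congr rfl fun J _ => ?_
      by_cases h : i ∈ J <;> simp [dropWeight, hi, hj, h, hm]
    rw [this, hm]
    simp only [hi, hj, hij, and_false, if_false]
    push_cast
    linear_combination (m * (m + 1 - r) : ℝ) * h1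
  · have hij : i ≠ j := fun h => hi (h ▸ hj)
    have h0 := key (T := {j}) (by simpa using hj) ((L.card : ℝ) * (L.card - r))
    have : ∑ J ∈ L.powersetCard r, dropWeight L r J i * dropWeight L r J j
        = (m.choose r : ℝ) * ((m + 1) * (m + 1 - r)) := by
      rw [card_singleton, hm] at h0
      push_cast at h0
      rw [← h0]
      refine Finset.sum_congr rfl fun J _ => ?_
      by_cases h : j ∈ J <;> simp [dropWeight, hi, hj, h, hm, mul_comm]
    rw [this, hm]
    simp only [hi, false_and, if_false]
    push_cast
    linear_combination (m * (m + 1 - r) : ℝ) * h1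
  · have : ∑ J ∈ L.powersetCard r, dropWeight L r J i * dropWeight L r J j
        = (L.card.choose r : ℝ) * ((L.card : ℝ) - r) ^ 2 := by
      simp [dropWeight, hi, hj, sq]
    rw [this]
    simp only [hi, false_and, if_false]
    ring

/-- Averaging the positivity of the `k × k` principal submatrices over all complements `J ⊆ L`. -/
theorem averaged_principal_submatrices {n k : ℕ} {M N : Matrix (Fin n) (Fin n) ℝ}
    (hM : M ∈ kPSDClosure n k) (hN : N.PosSemidef) (hkn : k ≤ n) {L : Finset (Fin n)}
    (hr : n - k < L.card) :
    0 ≤ ((L.card : ℝ) - (n - k : ℕ)) * ((L.card : ℝ) - 1) * (∑ i, ∑ j, N i j * M i j)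
      - (n - k : ℕ) * (∑ i ∈ L, ∑ j ∈ L, N i j * M i j)
      + L.card * (n - k : ℕ) * ∑ i ∈ L, N i i * M i i := by
  set r := n - k with hrdef
  have hJ : ∀ J ∈ L.powersetCard r,
      0 ≤ ∑ i, ∑ j, dropWeight L r J i * dropWeight L r J j * (N i j * M i j) := by
    intro J hJ
    obtain ⟨hJL, hJr⟩ := mem_powersetCard.1 hJ
    refine hN.sum_mul_nonneg _ fun x => ?_
    -- The weights vanish on `J`, and `Jᶜ` has exactly `k` elements.
    refine (hM.2 Jᶜ ?_).dotProduct_mulVec_of_support fun i hi => ?_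
    · rw [card_compl, Fintype.card_fin, hJr]
      omega
    · have hiJ : i ∈ J := by simpa using hi
      simp [dropWeight, hJL hiJ, hiJ]
  have hm : (0 : ℝ) ≤ (L.card : ℝ) - 1 := by
    have : 1 ≤ L.card := by omega
    have : (1 : ℝ) ≤ L.card := by exact_mod_cast this
    linarith
  have h0 := mul_nonneg hm (Finset.sum_nonneg hJ)
  have hswap : ((L.card : ℝ) - 1) * ∑ J ∈ L.powersetCard r,
      ∑ i, ∑ j, dropWeight L r J i * dropWeight L r J j * (N i j * M i j)
      = ∑ i, ∑ j, (((L.card : ℝ) - 1) * ∑ J ∈ L.powersetCard r,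
        dropWeight L r J i * dropWeight L r J j) * (N i j * M i j) := by
    rw [Finset.sum_comm, Finset.mul_sum]
    refine Finset.sum_congr rfl fun i _ => ?_
    rw [Finset.sum_comm, Finset.mul_sum]
    refine Finset.sum_congr rfl fun j _ => ?_
    rw [mul_assoc, Finset.sum_mul]
  rw [hswap] at h0
  simp only [sum_dropWeight_mul hr] at h0
  have hpos : (0 : ℝ) < L.card.choose r * ((L.card : ℝ) - r) := by
    have h1 : 0 < L.card.choose r := Nat.choose_pos hr.le
    have h2 : (r : ℝ) < L.card := by exact_mod_cast hr
    exact mul_pos (by exact_mod_cast h1) (by linarith)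
  refine nonneg_of_mul_nonneg_right (le_of_le_of_eq h0 ?_) hpos
  have hL : ∑ i ∈ L, ∑ j ∈ L, N i j * M i j
      = ∑ i, ∑ j, (if i ∈ L ∧ j ∈ L then 1 else 0) * (N i j * M i j) := by
    simp [ite_and]
  have hD : ∑ i ∈ L, N i i * M i i
      = ∑ i, ∑ j, (if i ∈ L ∧ i = j then 1 else 0) * (N i j * M i j) := by
    simp [ite_and]
  rw [hL, hD]
  simp only [Finset.mul_sum, ← Finset.sum_add_distrib, ← Finset.sum_sub_distrib]
  exact Finset.sum_congr rfl fun i _ => Finset.sum_congr rfl fun j _ => by ring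

theorem trace_mul_eq_sum_of_isHermitian {n : ℕ} (A : Matrix (Fin n) (Fin n) ℝ)
    {N : Matrix (Fin n) (Fin n) ℝ} (hN : N.IsHermitian) :
    (A * N).trace = ∑ i, ∑ j, N i j * A i j := by
  simp only [trace, diag_apply, mul_apply]
  refine Finset.sum_congr rfl fun i _ => Finset.sum_congr rfl fun j _ => ?_
  rw [mul_comm, ← hN.apply, star_trivial]

/-! ### Estimates for the negative part -/

/-- At least half of the diagonal entries are at most twice the average. -/
theorem two_mul_card_filter_le_two_mul_average {n : ℕ} (f : Fin n → ℝ) (hf : ∀ i, 0 ≤ f i) :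
    n ≤ 2 * (univ.filter fun i => n * f i ≤ 2 * ∑ j, f j).card := by
  set t := ∑ j, f j with ht
  set H := univ.filter fun i => ¬ (n * f i ≤ 2 * t) with hH
  have hcard := card_filter_add_card_filter_not (s := univ) fun i => n * f i ≤ 2 * t
  rw [card_univ, Fintype.card_fin] at hcard
  change n ≤ 2 * (univ.filter fun i => n * f i ≤ 2 * t).card
  suffices h : 2 * H.card ≤ n by
    rw [hH] at h
    omega
  by_contra! hlt
  have hne : H.Nonempty := card_pos.1 (by omega)
  have hgt : ∑ i ∈ H, 2 * t < ∑ i ∈ H, n * f i :=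
    Finset.sum_lt_sum_of_nonempty hne fun i hi => not_le.1 (mem_filter.1 hi).2
  rw [Finset.sum_const, nsmul_eq_mul, ← Finset.mul_sum] at hgt
  have hle : ∑ i ∈ H, f i ≤ t :=
    Finset.sum_le_sum_of_subset_of_nonneg (subset_univ _) fun i _ _ => hf i
  have ht0 : 0 ≤ t := Finset.sum_nonneg fun i _ => hf i
  have h1 : (n : ℝ) * ∑ i ∈ H, f i ≤ n * t := by gcongr
  have h2 : (n : ℝ) ≤ 2 * H.card := by exact_mod_cast hlt.le
  nlinarith [mul_le_mul_of_nonneg_right h2 ht0]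

/-- Square `hSD`, insert `hD` and cancel one factor `S`; `50 = 5² · 2`. -/
theorem le_cube_mul_of_mul_le {n r S Q D : ℝ} (hn : 0 < n) (hr : 0 ≤ r) (hS : 0 ≤ S) (hQ : 0 ≤ Q)
    (hSD : n / 5 * S ≤ r * D) (hD : D ^ 2 ≤ (2 * r * S / n) * Q) :
    S ≤ 50 * (r / n) ^ 3 * Q := by
  rcases hS.eq_or_lt with rfl | hpos
  · positivity
  · have hsq : (n / 5 * S) ^ 2 ≤ r ^ 2 * ((2 * r * S / n) * Q) := by
      calc (n / 5 * S) ^ 2 ≤ (r * D) ^ 2 := pow_le_pow_left₀ (by positivity) hSD 2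
        _ = r ^ 2 * D ^ 2 := by ring
        _ ≤ _ := mul_le_mul_of_nonneg_left hD (sq_nonneg r)
    have h2 : (n / 5 * S) ^ 2 = (n ^ 2 / 25 * S) * S := by ring
    have h3 : r ^ 2 * ((2 * r * S / n) * Q) = (n ^ 2 / 25 * S) * (50 * (r / n) ^ 3 * Q) := by
      field_simp
      ring
    rw [h2, h3] at hsq
    exact le_of_mul_le_mul_left hsq (by positivity)

/-- The negative part of a matrix in the `k`-PSD closure is small. -/
theorem exists_psd_decomposition_sum_sq_le {n k : ℕ} {M : Matrix (Fin n) (Fin n) ℝ}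
    (hM : M ∈ kPSDClosure n k) (hn : 97 ≤ n) (hkn : k ≤ n) (hk : 3 * (n : ℝ) / 4 ≤ (k : ℝ)) :
    ∃ P N : Matrix (Fin n) (Fin n) ℝ, P.PosSemidef ∧ M = P - N ∧
      ∑ i, ∑ j, N i j ^ 2 ≤ 50 * (((n : ℝ) - k) / n) ^ 3 * ∑ i, ∑ j, M i j ^ 2 := by
  have hH : M.IsHermitian := by
    rw [IsHermitian, conjTranspose_eq_transpose_of_trivial]
    exact hM.1
  obtain ⟨P, N, hP, hN, hPN, hz, htr, htr2⟩ := exists_spectral_split hH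
  refine ⟨P, N, hP, hPN, ?_⟩
  have hMij (i j : Fin n) : M i j = P i j - N i j := by rw [hPN, Matrix.sub_apply]
  set r := n - k with hr
  have hrR : (n : ℝ) - k = r := by rw [hr, Nat.cast_sub hkn]
  have hr4 : 4 * (r : ℝ) ≤ n := by linarith
  have hnR : (97 : ℝ) ≤ n := by exact_mod_cast hn
  set S := ∑ i, ∑ j, N i j ^ 2 with hS
  set Q := ∑ i, ∑ j, P i j ^ 2 with hQ
  set t := N.trace with ht
  have hNP : ∑ i, ∑ j, N i j * P i j = 0 := by
    rw [← trace_mul_eq_sum_of_isHermitian P hN.isHermitian, hz, trace_zero]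
  have hNN : (N * N).trace = S := by
    rw [trace_mul_eq_sum_of_isHermitian N hN.isHermitian]
    simp only [hS, sq]
  have hNM : ∑ i, ∑ j, N i j * M i j = -S := by
    simp only [hMij, mul_sub, Finset.sum_sub_distrib, hNP, hS, sq, zero_sub]
  have hMM : ∑ i, ∑ j, M i j ^ 2 = Q + S := by
    have h (i j : Fin n) : M i j ^ 2 = P i j ^ 2 + N i j ^ 2 - 2 * (N i j * P i j) := by
      rw [hMij]
      ring
    simp only [h, Finset.sum_sub_distrib, Finset.sum_add_distrib, ← Finset.mul_sum, hNP]
    ring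
  have hS0 : 0 ≤ S := Finset.sum_nonneg fun i _ => Finset.sum_nonneg fun j _ => sq_nonneg _
  have hQ0 : 0 ≤ Q := Finset.sum_nonneg fun i _ => Finset.sum_nonneg fun j _ => sq_nonneg _
  have ht0 : 0 ≤ t := hN.trace_nonneg
  -- Cauchy–Schwarz over the at most `r` nonzero eigenvalues of `N`.
  have htS : t ^ 2 ≤ r * S := by
    obtain ⟨J, hJ⟩ : ∃ J : Finset (Fin n), J.card = k := by
      obtain ⟨J, -, hJ⟩ := exists_subset_card_eq (s := (univ : Finset (Fin n))) (n := k)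
        (by simpa using hkn)
      exact ⟨J, hJ⟩
    have hcard := card_neg_eigenvalues_le hH (hM.2 J hJ)
    rw [hJ] at hcard
    rw [← hNN, htr, htr2]
    set T := univ.filter fun i => hH.eigenvalues i < 0 with hT
    have hzero (i : Fin n) (hi : i ∉ T) : max (-hH.eigenvalues i) 0 = 0 := by
      simpa [hT] using hi
    rw [← Finset.sum_subset (subset_univ T) fun i _ hi => hzero i hi,
      ← Finset.sum_subset (subset_univ T) fun i _ hi => by rw [hzero i hi]; norm_num]
    refine sq_sum_le_card_mul_sum_sq.trans ?_
    gcongr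
  set L := univ.filter fun i => n * N i i ≤ 2 * ∑ j, N j j with hL
  have hLcard : n ≤ 2 * L.card :=
    two_mul_card_filter_le_two_mul_average (fun i => N i i) fun i => hN.diag_nonneg
  have hm : (n : ℝ) ≤ 2 * L.card := by exact_mod_cast hLcard
  set m := L.card with hmdef
  have hrm : r < m := by
    have : (r : ℝ) < m := by linarith
    exact_mod_cast this
  have havg := averaged_principal_submatrices hM hN hkn hrm
  rw [hNM, ← hr, ← hmdef] at havg
  set D := ∑ i ∈ L, N i i * P i i with hD
  have hdiag : ∑ i ∈ L, N i i * M i i ≤ D :=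
    Finset.sum_le_sum fun i _ => by rw [hMij]; nlinarith [mul_self_nonneg (N i i)]
  have hLL : -S ≤ ∑ i ∈ L, ∑ j ∈ L, N i j * M i j := by
    have h1 : 0 ≤ ∑ i ∈ L, ∑ j ∈ L, N i j * P i j := by
      have h := hN.sum_mul_nonneg (fun i => if i ∈ L then 1 else 0) (B := P)
        fun x => by simpa using hP.dotProduct_mulVec_nonneg fun i => (if i ∈ L then 1 else 0) * x i
      simpa using h
    have h2 : ∑ i ∈ L, ∑ j ∈ L, N i j ^ 2 ≤ S := by
      refine (Finset.sum_le_sum fun i _ => Finset.sum_le_sum_of_subset_of_nonneg (subset_univ L)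
        fun j _ _ => sq_nonneg (N i j)).trans ?_
      exact Finset.sum_le_sum_of_subset_of_nonneg (subset_univ L)
        fun i _ _ => Finset.sum_nonneg fun j _ => sq_nonneg _
    have h3 : ∑ i ∈ L, ∑ j ∈ L, N i j * M i j
        = ∑ i ∈ L, ∑ j ∈ L, N i j * P i j - ∑ i ∈ L, ∑ j ∈ L, N i j ^ 2 := by
      simp only [hMij, mul_sub, Finset.sum_sub_distrib, sq]
    linarith
  have hr0 : (0 : ℝ) ≤ r := Nat.cast_nonneg r
  have hm0 : (0 : ℝ) < m := by linarith
  -- Here `(m - r)(m - 1) - r = m (m - 1 - r)`, so a factor `m` cancels.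
  have hmain : (m - 1 - r) * S ≤ r * D := by
    have h1 := mul_le_mul_of_nonneg_left hdiag (mul_nonneg hm0.le hr0)
    have h2 := mul_le_mul_of_nonneg_left hLL hr0
    refine le_of_mul_le_mul_left ?_ hm0
    nlinarith
  have hDsq : D ^ 2 ≤ (2 * r * S / n) * Q := by
    refine (Finset.sum_mul_sq_le_sq_mul_sq L _ _).trans ?_
    have h1 : ∑ i ∈ L, N i i ^ 2 ≤ 2 * r * S / n := by
      rw [le_div_iff₀ (by linarith), Finset.sum_mul]
      calc ∑ i ∈ L, N i i ^ 2 * n ≤ ∑ i ∈ L, N i i * (2 * t) := by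
            refine Finset.sum_le_sum fun i hi => ?_
            have h : n * N i i ≤ 2 * t := (mem_filter.1 hi).2
            have := mul_le_mul_of_nonneg_left h (hN.diag_nonneg (i := i))
            linarith
        _ ≤ t * (2 * t) := by
            rw [← Finset.sum_mul]
            gcongr
            exact Finset.sum_le_sum_of_subset_of_nonneg (subset_univ L)
              fun i _ _ => hN.diag_nonneg
        _ ≤ 2 * r * S := by linarith
    have h2 : ∑ i ∈ L, P i i ^ 2 ≤ Q := by
      refine (Finset.sum_le_sum_of_subset_of_nonneg (subset_univ L)
        fun i _ _ => sq_nonneg _).trans ?_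
      exact Finset.sum_le_sum fun i _ =>
        Finset.single_le_sum (f := fun j => P i j ^ 2) (fun j _ => sq_nonneg _) (mem_univ i)
    gcongr
  -- From `m ≥ n/2` and `r ≤ n/4`, the right side is at least `n/4 - 1`.
  have hn5 : (n : ℝ) / 5 ≤ m - 1 - r := by linarith
  have h5 : n / 5 * S ≤ r * D := (mul_le_mul_of_nonneg_right hn5 hS0).trans hmain
  rw [hMM, hrR]
  refine (le_cube_mul_of_mul_le (by linarith) hr0 hS0 hQ0 h5 hDsq).trans ?_
  gcongr
  linarith

/-! ### Passage to the Frobenius distance -/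

theorem sq_frobenius_norm {n : ℕ} (A : Matrix (Fin n) (Fin n) ℝ) :
    ‖A‖ ^ 2 = ∑ i, ∑ j, A i j ^ 2 := by
  rw [frobenius_norm_def, ← Real.sqrt_eq_rpow, Real.sq_sqrt (by positivity)]
  simp

theorem theorem2 (n k : ℕ) (hn : 97 ≤ n) (hkn : k ≤ n) (hk : 3 * (n : ℝ) / 4 ≤ (k : ℝ)) :
    normalizedFrobeniusDist (kPSDClosure n k) (psdCone n)
      ≤ 96 * (((n : ℝ) - (k : ℝ)) / (n : ℝ)) ^ (3 / 2 : ℝ) := by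
  refine (normalizedFrobeniusDist_isLUB (by omega) k).2 ?_
  rintro _ ⟨M, hM, hM1, rfl⟩
  obtain ⟨P, N, hP, hPN, hle⟩ := exists_psd_decomposition_sum_sq_le hM hn hkn hk
  have hdist : frobeniusDist M (psdCone n) ≤ ‖M - P‖ :=
    (frobeniusDist_psdCone_isGLB M).1 ⟨⟨P, hP⟩, rfl⟩
  refine hdist.trans ?_
  have hε : 0 ≤ ((n : ℝ) - k) / n :=
    div_nonneg (sub_nonneg.2 (by exact_mod_cast hkn)) (Nat.cast_nonneg n)
  set ε := ((n : ℝ) - k) / n with hεdef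
  have hpow : (ε ^ (3 / 2 : ℝ)) ^ 2 = ε ^ 3 := by
    rw [← Real.rpow_natCast, ← Real.rpow_mul hε, ← Real.rpow_natCast]
    norm_num
  rw [← sq_frobenius_norm, ← sq_frobenius_norm, hM1] at hle
  have hnorm : ‖M - P‖ = ‖N‖ := by
    rw [hPN, sub_sub_cancel_left, norm_neg]
  refine abs_le_of_sq_le_sq' ?_ (by positivity) |>.2
  rw [hnorm, mul_pow, hpow]
  -- Only `50 ≤ 96²` is needed.
  nlinarith [pow_nonneg hε 3]
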